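/- Let $V$ be a totally ordered set and let $n\ge 1$. Consider an asynchronous system of $n$ sequential, crash-prone processes that share $n$ atomic weak set objects $\mathit{SET}[0],\dots,\mathit{SET}[n-1]$, all initially empty. On a weak set, $\mathrm{add}(v)$ with $v\in V$ inserts $v$, and $\mathrm{get}()$ returns the set of all values added so far; each of these operations is one atomic step. Every process executes the following code, which does not depend on the process. - $\mathrm{propose}(v)$: set $\mathit{view}:=v$. For $i=0,\dots,n-1$ do: $\mathit{SET}[i].\mathrm{add}(\mathit{view})$; $\mathit{Snap}:=\mathit{SET}[i].\mathrm{get}()$; if $\#\mathit{Snap}\ge 2$ and $\mathit{view}=\min \mathit{Snap}$, then return $\mathit{ACK}$, otherwise set $\mathit{view}:=\min \mathit{Snap}$. After the loop return $\mathit{ACK}$. - $\mathrm{resolve}()$: $\mathit{Snap}:=\mathit{SET}[n-1].\mathrm{get}()$; if $\mathit{Snap}\ne\emptyset$ return $\min \mathit{Snap}$, otherwise return $\perp$. In an execution the steps of the processes are interleaved arbitrarily, any number of processes may crash, and each process performs, one after another and in any order, at most one $\mathrm{propose}$ operation and arbitrarily many $\mathrm{resolve}$ operations. A process that has not crashed and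 has a pending operation eventually takes a further step; this assumption is used only in Termination and Nontriviality. Theorem. This algorithm is an anonymous wait-free implementation of a safe agreement object over $V$. That is, all processes run the same code, and: 1. (Wait-freedom) Every operation returns after finitely many steps of the process that performs it, regardless of the speed and the crashes of the other processes. 2. (Responses) A $\mathrm{propose}$ operation returns $\mathit{ACK}$, and a $\mathrm{resolve}$ operation returns an element of $V$ or $\perp$. 3. (Validity) Every non-$\perp$ value returned by a $\mathrm{resolve}$ operation is the argument of some $\mathrm{propose}$ operation started before that return. 4. (Agreement) If two $\mathrm{resolve}$ operations return non-$\perp$ values $v$ and $v'$, then $v=v'$. 5. (Termination) Every operation performed by a non-faulty process eventually terminates. 6. (Nontriviality) If at least one $\mathrm{propose}$ operation is performed and no process fails while performing a $\mathrm{propose}$ operation, then there is a time after which no newly started $\mathrm{resolve}$ operation returns $\perp$ (so, by Termination, each one performed by a non-faulty process returns a value in $V$). -/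

import Mathlib

namespace SafeAgreement

universe u

/-! ## Asynchronous shared memory made of `n` atomic weak sets -/

/-- The operations of a safe agreement object. -/
inductive Request (V : Type u) : Type u
  | propose (v : V)
  | resolve

/-- The responses of a safe agreement object; `value none` stands for `⊥`. -/
inductive Response (V : Type u) : Type u
  | ack
  | value (o : Option V)

/-- What a running operation does in its next step: a local computation, one atomic `add` or `get`
on one of the `n` shared weak sets (followed by a change of the local state, which in the case of
`get` depends on the set that was returned), or returning a response to the caller. -/
inductive Move (V : Type u) (n : ℕ) (S : Type u) : Type u
  | tau (s : S)
  | add (i : Fin n) (v : V) (s : S)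
  | get (i : Fin n) (k : Finset V → S)
  | ret (r : Response V) (s : S)

/-- The sequential code of one process, as a deterministic automaton: its local states, the initial
one, how the invocation of an operation changes the local state, and the next move of a running
operation. -/
structure Program (V : Type u) (n : ℕ) : Type (u + 1) where
  State : Type u
  start : State
  invoke : Request V → State → State
  next : State → Move V n State

/-- An implementation for `n` processes, sharing `n` weak sets, assigns a code to each process. -/
abbrev Implementation (V : Type u) (n : ℕ) : Type (u + 1) := Fin n → Program V n

/-- All processes execute the same code, which starts in the same local state. -/
def Anonymous {V : Type u} {n : ℕ} (A : Implementation V n) : Prop := ∀ p q, A p = A q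

/-- A global configuration. `pending p` tells whether process `p` is performing an operation. -/
structure Config {V : Type u} {n : ℕ} (A : Implementation V n) : Type u where
  /-- the contents of the weak sets -/
  mem : Fin n → Finset V
  loc : (p : Fin n) → (A p).State
  pending : Fin n → Bool
  crashed : Fin n → Bool

/-- The initial configuration: the weak sets are empty, no operation is pending, no process has
crashed. -/
def Config.initial {V : Type u} {n : ℕ} (A : Implementation V n) : Config A where
  mem _ := ∅
  loc p := (A p).start
  pending _ := false
  crashed _ := false

/-- The events of an execution. -/
inductive Event (V : Type u) (n : ℕ) : Type u
  /-- process `p` starts an operation -/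
  | invoke (p : Fin n) (req : Request V)
  /-- process `p` makes a local step or accesses a weak set -/
  | step (p : Fin n)
  /-- the pending operation of process `p` returns `r` -/
  | respond (p : Fin n) (r : Response V)
  /-- process `p` fails -/
  | crash (p : Fin n)

/-- `Step c e c'`: the event `e` can happen in `c` and leads to `c'`. Processes are sequential: an
operation can be invoked only when none is pending. A crashed process does nothing any more. -/
inductive Step {V : Type u} [DecidableEq V] {n : ℕ} {A : Implementation V n} :
    Config A → Event V n → Config A → Prop
  | invoke (c : Config A) (p : Fin n) (req : Request V)
      (hc : c.crashed p = false) (hp : c.pending p = false) :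
      Step c (.invoke p req)
        { c with
          loc := Function.update c.loc p ((A p).invoke req (c.loc p))
          pending := Function.update c.pending p true }
  | tau (c : Config A) (p : Fin n) (s : (A p).State)
      (hc : c.crashed p = false) (hp : c.pending p = true)
      (h : (A p).next (c.loc p) = .tau s) :
      Step c (.step p) { c with loc := Function.update c.loc p s }
  | add (c : Config A) (p : Fin n) (i : Fin n) (v : V) (s : (A p).State)
      (hc : c.crashed p = false) (hp : c.pending p = true)
      (h : (A p).next (c.loc p) = .add i v s) :
      Step c (.step p)
        { c with
          mem := Function.update c.mem i (insert v (c.mem i))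
          loc := Function.update c.loc p s }
  | get (c : Config A) (p : Fin n) (i : Fin n) (k : Finset V → (A p).State)
      (hc : c.crashed p = false) (hp : c.pending p = true)
      (h : (A p).next (c.loc p) = .get i k) :
      Step c (.step p) { c with loc := Function.update c.loc p (k (c.mem i)) }
  | respond (c : Config A) (p : Fin n) (r : Response V) (s : (A p).State)
      (hc : c.crashed p = false) (hp : c.pending p = true)
      (h : (A p).next (c.loc p) = .ret r s) :
      Step c (.respond p r)
        { c with
          loc := Function.update c.loc p s
          pending := Function.update c.pending p false }
  | crash (c : Config A) (p : Fin n) (hc : c.crashed p = false) :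
      Step c (.crash p) { c with crashed := Function.update c.crashed p true }

/-- An execution: arbitrary interleaving of the events of the processes, with an arbitrary
environment invoking the operations and an arbitrary number of crashes. At some times nothing may
happen (event `none`), so that finite executions are included. The object is one-shot: a process
performs at most one `propose`. -/
structure Execution {V : Type u} [DecidableEq V] {n : ℕ} (A : Implementation V n) : Type u where
  config : ℕ → Config A
  event : ℕ → Option (Event V n)
  config_zero : config 0 = Config.initial A
  config_succ_of_none : ∀ t, event t = none → config (t + 1) = config t
  config_succ_of_some : ∀ t e, event t = some e → Step (config t) e (config (t + 1))
  one_shot : ∀ p s t v w, event s = some (.invoke p (.propose v)) →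
    event t = some (.invoke p (.propose w)) → s = t

namespace Execution

variable {V : Type u} [DecidableEq V] {n : ℕ} {A : Implementation V n}

/-- Process `p` starts the operation `req` at time `s`. -/
def Invokes (E : Execution A) (p : Fin n) (s : ℕ) (req : Request V) : Prop :=
  E.event s = some (.invoke p req)

/-- The operation that process `p` started at time `s` returns `r` at time `t`. -/
def Returns (E : Execution A) (p : Fin n) (s t : ℕ) (r : Response V) : Prop :=
  s < t ∧ E.event t = some (.respond p r) ∧
    ∀ t', s < t' → t' < t → ∀ r', E.event t' ≠ some (.respond p r')

/-- Process `p` executes a step of its code at time `t`. -/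
def TakesStep (E : Execution A) (p : Fin n) (t : ℕ) : Prop :=
  E.event t = some (.step p) ∨ ∃ r, E.event t = some (.respond p r)

/-- Process `p` fails in the execution. -/
def Faulty (E : Execution A) (p : Fin n) : Prop := ∃ t, E.event t = some (.crash p)

/-- A non-faulty process with a pending operation eventually takes a further step (at arbitrary
speed). -/
def Fair (E : Execution A) : Prop :=
  ∀ p, ¬ E.Faulty p → ∀ s, (E.config s).pending p = true → ∃ t, s ≤ t ∧ E.TakesStep p t

end Execution

/-! ## The properties of a safe agreement object -/

section Properties

variable {V : Type u} [DecidableEq V] {n : ℕ}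

/-- Wait-freedom: whatever the other processes do, whether they crash or stop, an operation of a
process returns after finitely many steps of that process. -/
def WaitFree (A : Implementation V n) : Prop :=
  ∀ (E : Execution A) (p : Fin n) (s : ℕ) (req : Request V), E.Invokes p s req →
    {t | s < t ∧ E.TakesStep p t}.Infinite → ∃ t r, E.Returns p s t r

/-- `propose` returns `ACK`, and `resolve` returns a value or `⊥`. -/
def ResponseTypes (A : Implementation V n) : Prop :=
  ∀ (E : Execution A) (p : Fin n) (s t : ℕ) (r : Response V), E.Returns p s t r →
    (∀ v, E.Invokes p s (.propose v) → r = .ack) ∧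
    (E.Invokes p s .resolve → ∃ o, r = .value o)

/-- A value returned by a `resolve` is the argument of a `propose` started before. -/
def Validity (A : Implementation V n) : Prop :=
  ∀ (E : Execution A) (p : Fin n) (s t : ℕ) (v : V), E.Invokes p s .resolve →
    E.Returns p s t (.value (some v)) → ∃ q t', t' < t ∧ E.Invokes q t' (.propose v)

/-- Any two values returned by `resolve` operations are equal. -/
def Agreement (A : Implementation V n) : Prop :=
  ∀ (E : Execution A) (p p' : Fin n) (s t s' t' : ℕ) (v v' : V),
    E.Invokes p s .resolve → E.Returns p s t (.value (some v)) →
    E.Invokes p' s' .resolve → E.Returns p' s' t' (.value (some v')) → v = v'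

/-- Every operation performed by a non-faulty process terminates. -/
def Termination (A : Implementation V n) : Prop :=
  ∀ E : Execution A, E.Fair → ∀ (p : Fin n) (s : ℕ) (req : Request V), E.Invokes p s req →
    ¬ E.Faulty p → ∃ t r, E.Returns p s t r

/-- If a `propose` is performed, and no process fails while performing a `propose`, then from some
time on no newly started `resolve` returns `⊥`. -/
def Nontriviality (A : Implementation V n) : Prop :=
  ∀ E : Execution A, E.Fair →
    (∃ q u v, E.Invokes q u (.propose v)) →
    (∀ q u v, E.Invokes q u (.propose v) → ∀ c, u < c → E.event c = some (.crash q) →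
      ∃ t r, t < c ∧ E.Returns q u t r) →
    ∃ T, ∀ p s t r, T ≤ s → E.Invokes p s .resolve → E.Returns p s t r →
      ∃ v, r = .value (some v)

end Properties

/-! ## The algorithm

```
operation propose(v):
  view = v
  for i = 0, ..., n-1 do
    SET[i].add(view)
    Snap = SET[i].get()
    if #Snap >= 2 and view == min(Snap) then return ACK
    else view = min(Snap)
  return ACK

operation resolve():
  Snap = SET[n-1].get()
  if Snap nonempty then return min(Snap) else return ⊥
```
-/

section Algorithm

variable {V : Type u} [LinearOrder V] {n : ℕ}

/-- The control points of the code, each with the current values of the local variables that are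
still going to be used. -/
inductive Ctrl (V : Type u) (n : ℕ) : Type u
  /-- no operation is running -/
  | idle
  /-- about to execute `view = v` -/
  | input (v : V)
  /-- at the head of the loop, with loop counter `i` -/
  | loop (view : V) (i : ℕ)
  /-- about to execute `SET[i].add(view)` -/
  | addView (view : V) (i : Fin n)
  /-- about to execute `Snap = SET[i].get()` -/
  | getSnap (view : V) (i : Fin n)
  /-- about to evaluate `#Snap >= 2 and view == min(Snap)` -/
  | test (view : V) (i : Fin n) (snap : Finset V)
  /-- about to execute `view = min(Snap)` -/
  | update (i : Fin n) (snap : Finset V)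
  /-- about to execute `return ACK` -/
  | ack
  /-- about to execute `Snap = SET[n-1].get()` -/
  | getLast
  /-- about to test whether `Snap` is nonempty -/
  | testEmpty (snap : Finset V)
  /-- about to execute `return min(Snap)` -/
  | retMin (snap : Finset V)
  /-- about to execute `return ⊥` -/
  | retBot

/-- The next move at each control point. The minimum of an empty set does not exist; code that had
to compute it would be stuck forever. -/
def Ctrl.next (hn : 0 < n) : Ctrl V n → Move V n (Ctrl V n)
  | .idle => .tau .idle
  | .input v => .tau (.loop v 0)
  | .loop view i => if h : i < n then .tau (.addView view ⟨i, h⟩) else .tau .ack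
  | .addView view i => .add i view (.getSnap view i)
  | .getSnap view i => .get i (fun snap => .test view i snap)
  | .test view i snap =>
      if 2 ≤ snap.card ∧ snap.min = (view : WithTop V) then .tau .ack else .tau (.update i snap)
  | .update i snap =>
      if h : snap.Nonempty then .tau (.loop (snap.min' h) (i.val + 1)) else .tau (.update i snap)
  | .ack => .ret .ack .idle
  | .getLast => .get ⟨n - 1, Nat.sub_lt hn Nat.one_pos⟩ (fun snap => .testEmpty snap)
  | .testEmpty snap => if snap.Nonempty then .tau (.retMin snap) else .tau .retBot
  | .retMin snap =>
      if h : snap.Nonempty then .ret (.value (some (snap.min' h))) .idle else .tau (.retMin snap)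
  | .retBot => .ret (.value none) .idle

/-- The code executed by every process. -/
def code (V : Type u) [LinearOrder V] (n : ℕ) (hn : 0 < n) : Program V n where
  State := Ctrl V n
  start := .idle
  invoke req _ := match req with
    | .propose v => .input v
    | .resolve => .getLast
  next := Ctrl.next hn

/-- The algorithm for `n` processes. -/
def algorithm (V : Type u) [LinearOrder V] (n : ℕ) (hn : 0 < n) : Implementation V n :=
  fun _ => code V n hn

end Algorithm

end SafeAgreement

/-! Agreement: at each weak set, a competition removes at least one process or unifies the views.
Let `m` be the least value in `SET[i]` up to a time `T`, and `q` the first process to add it. If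
`SET[i]` was empty before that addition, every later snapshot contains `m`, so everyone leaves
iteration `i` with view `m`. Otherwise `q` sees its own value `m` as the minimum of at least two
values and stops there. By induction, `SET[i]` has at most `n - i` adders or at most one value
(`adders_or_subsingleton`); for `i = n - 1` either alternative leaves a single value
(`eq_of_mem_last`).

Nontriviality: once all proposals are over, take the highest nonempty weak set and a process that
added its maximum. If this set were not the last one, that process would have stopped there, having
seen its value as the minimum of two or more values, which is absurd for the maximum
(`last_nonempty`).

Wait-freedom follows from a rank that drops at every step. Validity is an invariant on all stored
values. The bookkeeping rests on the invariant `history`, which reads the past of a process off its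
control point. -/

namespace SafeAgreement

universe u

section Proof

variable {V : Type u} [LinearOrder V] {n : ℕ} {hn : 0 < n}

/-! ## Local transitions of the code -/

/-- The last of the shared weak sets. -/
def lastIdx (hn : 0 < n) : Fin n := ⟨n - 1, Nat.sub_lt hn Nat.one_pos⟩

/-- The control point at which an operation starts. -/
def Ctrl.entry : Request V → Ctrl V n
  | .propose v => .input v
  | .resolve => .getLast

/-- The internal transitions of the code when the weak sets contain `m`. -/
inductive Trans (hn : 0 < n) (m : Fin n → Finset V) : Ctrl V n → Ctrl V n → Prop
  | idle : Trans hn m .idle .idle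
  | input (v : V) : Trans hn m (.input v) (.loop v 0)
  | loop (v : V) (i : Fin n) : Trans hn m (.loop v i.val) (.addView v i)
  | loopEnd (v : V) (i : ℕ) (h : n ≤ i) : Trans hn m (.loop v i) .ack
  | addView (v : V) (i : Fin n) : Trans hn m (.addView v i) (.getSnap v i)
  | getSnap (v : V) (i : Fin n) : Trans hn m (.getSnap v i) (.test v i (m i))
  | testAck (v : V) (i : Fin n) (snap : Finset V)
      (h : 2 ≤ snap.card ∧ snap.min = (v : WithTop V)) : Trans hn m (.test v i snap) .ack
  | testPass (v : V) (i : Fin n) (snap : Finset V)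
      (h : ¬ (2 ≤ snap.card ∧ snap.min = (v : WithTop V))) :
      Trans hn m (.test v i snap) (.update i snap)
  | update (i : Fin n) (snap : Finset V) (h : snap.Nonempty) :
      Trans hn m (.update i snap) (.loop (snap.min' h) (i.val + 1))
  | updateStuck (i : Fin n) (snap : Finset V) (h : ¬ snap.Nonempty) :
      Trans hn m (.update i snap) (.update i snap)
  | getLast : Trans hn m .getLast (.testEmpty (m (lastIdx hn)))
  | testNonempty (snap : Finset V) (h : snap.Nonempty) : Trans hn m (.testEmpty snap) (.retMin snap)
  | testEmpty (snap : Finset V) (h : ¬ snap.Nonempty) : Trans hn m (.testEmpty snap) .retBot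
  | retMinStuck (snap : Finset V) (h : ¬ snap.Nonempty) : Trans hn m (.retMin snap) (.retMin snap)

/-- The responses of the code. -/
inductive Ret : Ctrl V n → Response V → Prop
  | ack : Ret .ack .ack
  | retMin (snap : Finset V) (h : snap.Nonempty) : Ret (.retMin snap) (.value (some (snap.min' h)))
  | retBot : Ret .retBot (.value none)

/-- The second conjunct lets `mem_succ` conclude that such a step is not an addition, since `Adds`
is read off the control point. -/
theorem trans_of_next_tau {m : Fin n → Finset V} {c s : Ctrl V n}
    (h : Ctrl.next hn c = .tau s) : Trans hn m c s ∧ ∀ v i, c ≠ .addView v i := by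
  cases c <;> simp only [Ctrl.next] at h <;> (try split_ifs at h) <;> cases h <;>
    refine ⟨?_, by simp⟩
  · exact .idle
  · exact .input _
  · rename_i v i h; exact .loop v ⟨i, h⟩
  · exact .loopEnd _ _ (by omega)
  · exact .testAck _ _ _ ‹_›
  · exact .testPass _ _ _ ‹_›
  · exact .update _ _ _
  · exact .updateStuck _ _ ‹_›
  · exact .testNonempty _ ‹_›
  · exact .testEmpty _ ‹_›
  · exact .retMinStuck _ ‹_›

theorem eq_of_next_add {c s : Ctrl V n} {i : Fin n} {v : V}
    (h : Ctrl.next hn c = .add i v s) : c = .addView v i ∧ s = .getSnap v i := by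
  cases c <;> simp only [Ctrl.next] at h <;> (try split_ifs at h) <;> cases h
  exact ⟨rfl, rfl⟩

theorem trans_of_next_get {m : Fin n → Finset V} {c : Ctrl V n} {i : Fin n}
    {k : Finset V → Ctrl V n} (h : Ctrl.next hn c = .get i k) :
    Trans hn m c (k (m i)) ∧ ∀ v i, c ≠ .addView v i := by
  cases c <;> simp only [Ctrl.next] at h <;> (try split_ifs at h) <;> cases h <;>
    refine ⟨?_, by simp⟩
  · exact .getSnap _ _
  · exact .getLast

theorem ret_of_next_ret {c s : Ctrl V n} {r : Response V}
    (h : Ctrl.next hn c = .ret r s) : Ret c r ∧ s = .idle := by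
  cases c <;> simp only [Ctrl.next] at h <;> (try split_ifs at h) <;> cases h <;>
    refine ⟨?_, rfl⟩
  · exact .ack
  · exact .retMin _ _
  · exact .retBot

/-! ## Executions of the algorithm -/

namespace Execution

variable (E : Execution (algorithm V n hn))

/-- The control point of process `p` at time `t`. -/
def ctrl (p : Fin n) (t : ℕ) : Ctrl V n := (E.config t).loc p

/-- The contents of the weak sets at time `t`. -/
def mem (t : ℕ) : Fin n → Finset V := (E.config t).mem

/-- Whether process `p` is performing an operation at time `t`. -/
def pend (p : Fin n) (t : ℕ) : Bool := (E.config t).pending p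

/-- Process `p` adds `v` to the weak set `i` at time `t`. -/
def Adds (p : Fin n) (i : Fin n) (v : V) (t : ℕ) : Prop :=
  E.event t = some (.step p) ∧ E.ctrl p t = .addView v i

/-- What can happen to process `p` at time `t`. -/
inductive Moves (p : Fin n) (t : ℕ) : Prop
  | stay (hc : E.ctrl p (t + 1) = E.ctrl p t) (hp : E.pend p (t + 1) = E.pend p t)
      (hi : ∀ req, E.event t ≠ some (.invoke p req)) (hs : ¬ E.TakesStep p t)
  | invoke (req : Request V) (he : E.event t = some (.invoke p req))
      (hc : E.ctrl p (t + 1) = .entry req) (hp : E.pend p t = false)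
      (hp' : E.pend p (t + 1) = true)
  | step (he : E.event t = some (.step p))
      (hc : Trans hn (E.mem t) (E.ctrl p t) (E.ctrl p (t + 1))) (hp : E.pend p t = true)
      (hp' : E.pend p (t + 1) = true)
  | respond (r : Response V) (he : E.event t = some (.respond p r)) (hr : Ret (E.ctrl p t) r)
      (hc : E.ctrl p (t + 1) = .idle) (hp : E.pend p t = true) (hp' : E.pend p (t + 1) = false)

/-- Projects the global step relation to one process; the invariants on control points below are
proved by induction on time with these four cases. -/
theorem moves (p : Fin n) (t : ℕ) : E.Moves p t := by
  rcases he : E.event t with _ | e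
  · have := E.config_succ_of_none t he
    exact .stay (by simp [ctrl, this]; rfl) (by simp [pend, this]) (by simp [he]) (by simp [TakesStep, he])
  have h := E.config_succ_of_some t e he
  generalize hc : E.config t = c at h
  generalize hc' : E.config (t + 1) = c' at h
  cases h with
  | invoke q req h1 h2 =>
    by_cases hq : p = q
    · subst hq
      refine .invoke req he ?_ (by simp [pend, hc, h2]) (by simp [pend, hc'])
      simp only [ctrl, hc', Function.update_self]
      cases req <;> rfl
    · exact .stay (by simp [ctrl, hc, hc', hq]; rfl) (by simp [pend, hc, hc', hq])
        (by simp [he, Ne.symm hq]) (by simp [TakesStep, he])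
  | tau q s h1 h2 h3 =>
    by_cases hq : p = q
    · subst hq
      refine .step he ?_ (by simp [pend, hc, h2]) (by simp [pend, hc', h2])
      simp only [ctrl, mem, hc', hc, Function.update_self]
      exact (trans_of_next_tau h3).1
    · exact .stay (by simp [ctrl, hc, hc', hq]; rfl) (by simp [pend, hc, hc'])
        (by simp [he]) (by simp [TakesStep, he, Ne.symm hq])
  | add q i v s h1 h2 h3 =>
    by_cases hq : p = q
    · subst hq
      refine .step he ?_ (by simp [pend, hc, h2]) (by simp [pend, hc', h2])
      simp only [ctrl, mem, hc', hc, Function.update_self]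
      obtain ⟨h4, h5⟩ := eq_of_next_add (hn := hn) h3
      rw [h4, h5]
      exact .addView _ _
    · exact .stay (by simp [ctrl, hc, hc', hq]; rfl) (by simp [pend, hc, hc'])
        (by simp [he]) (by simp [TakesStep, he, Ne.symm hq])
  | get q i k h1 h2 h3 =>
    by_cases hq : p = q
    · subst hq
      refine .step he ?_ (by simp [pend, hc, h2]) (by simp [pend, hc', h2])
      simp only [ctrl, mem, hc', hc, Function.update_self]
      exact (trans_of_next_get h3).1
    · exact .stay (by simp [ctrl, hc, hc', hq]; rfl) (by simp [pend, hc, hc'])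
        (by simp [he]) (by simp [TakesStep, he, Ne.symm hq])
  | respond q r s h1 h2 h3 =>
    by_cases hq : p = q
    · subst hq
      obtain ⟨h4, h5⟩ := ret_of_next_ret (hn := hn) h3
      refine .respond r he ?_ ?_ (by simp [pend, hc, h2]) (by simp [pend, hc'])
      · simpa only [ctrl, hc] using h4
      · simpa only [ctrl, hc', Function.update_self] using h5
    · exact .stay (by simp [ctrl, hc, hc', hq]; rfl) (by simp [pend, hc, hc', hq])
        (by simp [he]) (by simp [TakesStep, he, Ne.symm hq])
  | crash q h1 =>
    exact .stay (by simp [ctrl, hc, hc']; rfl) (by simp [pend, hc, hc'])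
      (by simp [he]) (by simp [TakesStep, he])

/-- The absence of additions in the first alternative is what makes every addition visible in the
memory (`Adds.mem_of_lt`). -/
theorem mem_succ (t : ℕ) :
    (E.mem (t + 1) = E.mem t ∧ ∀ p i v, ¬ E.Adds p i v t) ∨
    ∃ p i v, E.Adds p i v t ∧ E.mem (t + 1) = Function.update (E.mem t) i (insert v (E.mem t i)) := by
  rcases he : E.event t with _ | e
  · have := E.config_succ_of_none t he
    exact .inl ⟨by simp [mem, this], by simp [Adds, he]⟩
  have h := E.config_succ_of_some t e he
  generalize hc : E.config t = c at h
  generalize hc' : E.config (t + 1) = c' at h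
  cases h with
  | invoke q req h1 h2 => exact .inl ⟨by simp [mem, hc, hc'], by simp [Adds, he]⟩
  | tau q s h1 h2 h3 =>
    refine .inl ⟨by simp [mem, hc, hc'], ?_⟩
    rintro p i v ⟨h4, h5⟩
    obtain rfl : q = p := by simpa [he] using h4
    rw [ctrl, hc] at h5
    exact (trans_of_next_tau (hn := hn) (m := c.mem) h3).2 _ _ h5
  | add q i v s h1 h2 h3 =>
    exact .inr ⟨q, i, v, ⟨he, by rw [ctrl, hc]; exact (eq_of_next_add (hn := hn) h3).1⟩, by simp [mem, hc, hc']⟩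
  | get q i k h1 h2 h3 =>
    refine .inl ⟨by simp [mem, hc, hc'], ?_⟩
    rintro p i v ⟨h4, h5⟩
    obtain rfl : q = p := by simpa [he] using h4
    rw [ctrl, hc] at h5
    exact (trans_of_next_get (hn := hn) (m := c.mem) h3).2 _ _ h5
  | respond q r s h1 h2 h3 => exact .inl ⟨by simp [mem, hc, hc'], by simp [Adds, he]⟩
  | crash q h1 => exact .inl ⟨by simp [mem, hc, hc'], by simp [Adds, he]⟩

theorem ctrl_zero (p : Fin n) : E.ctrl p 0 = .idle := by
  rw [ctrl, E.config_zero]; rfl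

theorem pend_zero (p : Fin n) : E.pend p 0 = false := by
  rw [pend, E.config_zero]; rfl

theorem mem_zero (i : Fin n) : E.mem 0 i = ∅ := by
  rw [mem, E.config_zero]; rfl

variable {E}

theorem mem_mono {s t : ℕ} (h : s ≤ t) (i : Fin n) : E.mem s i ⊆ E.mem t i := by
  induction t, h using Nat.le_induction with
  | base => exact subset_rfl
  | succ t _ ih =>
    refine ih.trans ?_
    rcases E.mem_succ t with ⟨h, -⟩ | ⟨p, j, v, -, h⟩
    · rw [h]
    · rw [h]
      rcases eq_or_ne i j with rfl | hij
      · simp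
      · simp [hij]

theorem Adds.mem_of_lt {p i : Fin n} {v : V} {s t : ℕ} (h : E.Adds p i v s) (hst : s < t) :
    v ∈ E.mem t i := by
  refine mem_mono (Nat.succ_le_of_lt hst) i ?_
  rcases E.mem_succ s with ⟨-, h'⟩ | ⟨q, j, w, h', hm⟩
  · exact absurd h (h' _ _ _)
  · obtain rfl : p = q := by simpa [h.1] using h'.1
    have := h.2.symm.trans h'.2
    obtain ⟨rfl, rfl⟩ : v = w ∧ i = j := by simpa using this
    rw [Nat.succ_eq_add_one, hm]
    simp

theorem exists_adds_of_mem {t : ℕ} {i : Fin n} {v : V} (h : v ∈ E.mem t i) :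
    ∃ p s, s < t ∧ E.Adds p i v s := by
  induction t with
  | zero => simp [mem_zero] at h
  | succ t ih =>
    have old : v ∈ E.mem t i → ∃ p s, s < t + 1 ∧ E.Adds p i v s := fun h => by
      obtain ⟨p, s, hs, ha⟩ := ih h
      exact ⟨p, s, by omega, ha⟩
    rcases E.mem_succ t with ⟨h', -⟩ | ⟨q, j, w, h', hm⟩
    · exact old (h' ▸ h)
    · rw [hm] at h
      rcases eq_or_ne i j with rfl | hij
      · rw [Function.update_self, Finset.mem_insert] at h
        rcases h with rfl | h
        · exact ⟨q, t, by omega, h'⟩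
        · exact old h
      · exact old (by simpa [hij] using h)

/-! ## Wait-freedom -/

/-- The code is not stuck: snapshots of which the minimum is computed are nonempty, and a pending
operation has a control point in the code. -/
def _root_.SafeAgreement.Ctrl.Sound (m : Fin n → Finset V) (b : Bool) : Ctrl V n → Prop
  | .idle => b = false
  | .getSnap v i => v ∈ m i
  | .test _ _ snap => snap.Nonempty
  | .update _ snap => snap.Nonempty
  | .testEmpty snap => snap ⊆ m (lastIdx hn)
  | .retMin snap => snap.Nonempty ∧ snap ⊆ m (lastIdx hn)
  | _ => True

/-- A process gets from a weak set only after adding to it, and weak sets only grow, so its snapshot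
contains at least its own view. -/
theorem sound (p : Fin n) (t : ℕ) : (E.ctrl p t).Sound (hn := hn) (E.mem t) (E.pend p t) := by
  induction t with
  | zero => rw [ctrl_zero, pend_zero]; rfl
  | succ t ih =>
    have mono := fun i => E.mem_mono (Nat.le_succ t) i
    rcases E.moves p t with ⟨hc, hp, -, -⟩ | ⟨req, -, hc, -, -⟩ | ⟨he, hc, hp, hp'⟩ |
      ⟨r, -, -, hc, -, hp'⟩
    · rw [hc, hp]
      cases h : E.ctrl p t <;> rw [h] at ih
      case getSnap => exact mono _ ih
      case testEmpty => exact ih.trans (mono _)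
      case retMin => exact ⟨ih.1, ih.2.trans (mono _)⟩
      all_goals exact ih
    · rw [hc]; cases req <;> trivial
    · rw [hp']
      rw [hp] at ih
      generalize h : E.ctrl p t = c at hc ih
      generalize h' : E.ctrl p (t + 1) = c' at hc
      cases hc with
      | addView v i => exact Adds.mem_of_lt ⟨he, h⟩ (Nat.lt_succ_self t)
      | getSnap v i => exact ⟨v, ih⟩
      | testPass v i snap _ => exact ih
      | getLast => exact mono _
      | testNonempty snap hs => exact ⟨hs, ih.trans (mono _)⟩
      | retMinStuck snap hs => exact absurd ih.1 hs
      | idle => exact ih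
      | updateStuck i snap hs => exact absurd ih hs
      | _ => trivial
    · rw [hc, hp']; rfl

/-- A bound on the number of steps until the current operation returns. -/
def _root_.SafeAgreement.Ctrl.rank : Ctrl V n → ℕ
  | .idle => 0
  | .input _ => 5 * n + 3
  | .loop _ i => 5 * (n - i) + 2
  | .addView _ i => 5 * (n - i.val) + 1
  | .getSnap _ i => 5 * (n - i.val)
  | .test _ i _ => 5 * (n - i.val) - 1
  | .update i _ => 5 * (n - i.val) - 2
  | .ack => 1
  | .getLast => 3
  | .testEmpty _ => 2
  | .retMin _ => 1
  | .retBot => 1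

/-- One iteration passes through five control points, hence the factor 5 in `rank`. Soundness rules
out the self-loops, which would not lower the rank. -/
theorem rank_lt_of_trans {m m' : Fin n → Finset V} {c c' : Ctrl V n} (h : Trans hn m c c')
    (hs : c.Sound (hn := hn) m' true) : c'.rank < c.rank := by
  cases h with
  | idle => exact absurd hs (by simp [Ctrl.Sound])
  | updateStuck i snap h => exact absurd hs h
  | retMinStuck snap h => exact absurd hs.1 h
  | addView v i | getSnap v i | testAck v i snap _ | testPass v i snap _ | update i snap _ =>
    have := i.isLt
    simp only [Ctrl.rank]
    omega
  | _ => simp [Ctrl.rank]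

/-- An operation that never returns stays pending. -/
theorem pend_of_not_returns {p : Fin n} {s : ℕ} {req : Request V} (hi : E.Invokes p s req)
    (h : ¬ ∃ t r, E.Returns p s t r) {t : ℕ} (ht : s < t) :
    E.pend p t = true ∧ ∀ r, E.event t ≠ some (.respond p r) := by
  -- `Returns` asks for the first response after `s`; strong induction shows that any response would
  -- be the first.
  have nr : ∀ t, s < t → ∀ r, E.event t ≠ some (.respond p r) := by
    intro t
    induction t using Nat.strong_induction_on with
    | _ t ih => exact fun ht r hr => h ⟨t, r, ht, hr, fun t' h1 h2 r' => ih t' h2 h1 r'⟩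
  refine ⟨?_, nr t ht⟩
  induction t, ht using Nat.le_induction with
  | base =>
    rcases E.moves p s with ⟨-, -, h, -⟩ | ⟨_, -, -, -, hp⟩ | ⟨he, _, _, _⟩ | ⟨_, he, _, _, _, _⟩
    · exact absurd hi (h _)
    · exact hp
    · simp [Invokes, he] at hi
    · simp [Invokes, he] at hi
  | succ t ht ih =>
    rcases E.moves p t with ⟨-, hp, -, -⟩ | ⟨_, -, -, -, hp⟩ | ⟨he, _, _, hp⟩ | ⟨_, he, _, _, _, _⟩
    · exact hp.trans ih
    · exact hp
    · exact hp
    · exact absurd he (nr t ht _)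

theorem exists_returns_of_infinite {p : Fin n} {s : ℕ} {req : Request V} (hi : E.Invokes p s req)
    (hinf : {t | s < t ∧ E.TakesStep p t}.Infinite) : ∃ t r, E.Returns p s t r := by
  by_contra hret
  have key : ∀ t, s < t → (E.ctrl p (t + 1)).rank ≤ (E.ctrl p t).rank ∧
      (E.TakesStep p t → (E.ctrl p (t + 1)).rank < (E.ctrl p t).rank) := by
    intro t ht
    obtain ⟨h1, h2⟩ := pend_of_not_returns hi hret ht
    rcases E.moves p t with ⟨hc, -, -, hs⟩ | ⟨_, -, -, hp, -⟩ | ⟨_, hc, hp, _⟩ | ⟨_, he, _, _, _, _⟩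
    · exact ⟨by rw [hc], fun h => absurd h hs⟩
    · simp [hp] at h1
    · have := sound (E := E) p t
      rw [hp] at this
      have := rank_lt_of_trans hc this
      exact ⟨this.le, fun _ => this⟩
    · exact absurd he (h2 _)
  have anti : ∀ t, s < t → ∀ t', t ≤ t' → (E.ctrl p t').rank ≤ (E.ctrl p t).rank := by
    intro t ht t' htt'
    induction t', htt' using Nat.le_induction with
    | base => exact le_rfl
    | succ t' h ih => exact (key t' (by omega)).1.trans ih
  -- Infinitely many steps of `p`, each lowering a natural number that never rises in between:
  -- infinite descent.
  have : ∀ k t, s < t → (E.ctrl p t).rank = k → False := by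
    intro k
    induction k using Nat.strong_induction_on with
    | _ k ih =>
      intro t ht hk
      obtain ⟨t', ⟨h1, h2⟩, h3⟩ := hinf.exists_gt t
      have h4 := (key t' h1).2 h2
      have h5 := anti t ht t' h3.le
      exact ih _ (by omega) (t' + 1) (by omega) rfl
  exact this _ (s + 1) (by omega) rfl

theorem exists_returns_of_fair (hF : E.Fair) {p : Fin n} {s : ℕ} {req : Request V}
    (hi : E.Invokes p s req) (hp : ¬ E.Faulty p) : ∃ t r, E.Returns p s t r := by
  by_contra hret
  refine hret (exists_returns_of_infinite hi ?_)
  refine Set.infinite_of_forall_exists_gt fun a => ?_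
  obtain ⟨t, h1, h2⟩ := hF p hp (max s a + 1) (pend_of_not_returns hi hret (by omega)).1
  exact ⟨t, ⟨by omega, h2⟩, by omega⟩

/-! ## Control points during one operation -/

theorem ret_of_returns {p : Fin n} {s t : ℕ} {r : Response V} (h : E.Returns p s t r) :
    Ret (E.ctrl p t) r := by
  have h1 := h.2.1
  rcases E.moves p t with ⟨-, -, -, hs⟩ | ⟨_, he, -, -, -⟩ | ⟨he, _, _, _⟩ | ⟨r', he, hr, _, _, _⟩
  · exact absurd (Or.inr ⟨r, h1⟩) hs
  · simp [he] at h1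
  · simp [he] at h1
  · obtain rfl : r' = r := by simpa [he] using h1
    exact hr

/-- A property of control points that holds at the start of an operation and is preserved by its
transitions holds when the operation returns. -/
theorem ctrl_of_returns {p : Fin n} {s t : ℕ} {req : Request V} {r : Response V}
    (hi : E.Invokes p s req) (h : E.Returns p s t r) (Q : Ctrl V n → Prop) (h0 : Q (.entry req))
    (hQ : ∀ t', s ≤ t' → ∀ c c', Trans hn (E.mem t') c c' → Q c → Q c') : Q (E.ctrl p t) := by
  obtain ⟨hst, -, hno⟩ := h
  have : ∀ t', s + 1 ≤ t' → t' ≤ t → E.pend p t' = true ∧ Q (E.ctrl p t') := by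
    intro t' ht'
    induction t', ht' using Nat.le_induction with
    | base =>
      intro _
      rcases E.moves p s with ⟨-, -, h, -⟩ | ⟨req', he, hc, -, hp⟩ | ⟨he, _, _, _⟩ |
        ⟨_, he, _, _, _, _⟩
      · exact absurd hi (h _)
      · obtain rfl : req' = req := by simpa [he, Invokes] using hi
        exact ⟨hp, hc ▸ h0⟩
      · simp [Invokes, he] at hi
      · simp [Invokes, he] at hi
    | succ t' ht' ih =>
      intro htt
      obtain ⟨ih1, ih2⟩ := ih (by omega)
      rcases E.moves p t' with ⟨hc, hp, -, -⟩ | ⟨_, -, -, hp, -⟩ | ⟨_, hc, _, hp⟩ |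
        ⟨_, he, _, _, _, _⟩
      · exact ⟨hp.trans ih1, hc ▸ ih2⟩
      · simp [hp] at ih1
      · exact ⟨hp, hQ t' (by omega) _ _ hc ih2⟩
      · exact absurd he (hno t' (by omega) (by omega) _)
  exact (this t hst le_rfl).2

/-- The control points of `propose`. -/
def _root_.SafeAgreement.Ctrl.Proposing : Ctrl V n → Prop
  | .input _ | .loop _ _ | .addView _ _ | .getSnap _ _ | .test _ _ _ | .update _ _ | .ack => True
  | _ => False

/-- The control points of `resolve`. -/
def _root_.SafeAgreement.Ctrl.Resolving : Ctrl V n → Prop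
  | .getLast | .testEmpty _ | .retMin _ | .retBot => True
  | _ => False

theorem returns_propose {p : Fin n} {s t : ℕ} {r : Response V} {v : V}
    (h : E.Returns p s t r) (hi : E.Invokes p s (.propose v)) : E.ctrl p t = .ack ∧ r = .ack := by
  have h1 := ctrl_of_returns hi h Ctrl.Proposing trivial (by
    intro _ _ c c' ht hc; cases ht <;> trivial)
  have h2 := ret_of_returns h
  generalize E.ctrl p t = c at h1 h2
  cases h2 <;> first | exact ⟨rfl, rfl⟩ | exact h1.elim

theorem returns_resolve {p : Fin n} {s t : ℕ} {r : Response V}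
    (h : E.Returns p s t r) (hi : E.Invokes p s .resolve) : ∃ o, r = .value o := by
  have h1 := ctrl_of_returns hi h Ctrl.Resolving trivial (by
    intro _ _ c c' ht hc; cases ht <;> trivial)
  have h2 := ret_of_returns h
  generalize E.ctrl p t = c at h1 h2
  cases h2 <;> first | exact ⟨_, rfl⟩ | exact h1.elim

/-- The snapshot is taken no earlier than the invocation, so it contains everything that was in the
last weak set at time `s`. -/
theorem returns_resolve_of_nonempty {p : Fin n} {s t : ℕ} {r : Response V}
    (h : E.Returns p s t r) (hi : E.Invokes p s .resolve) (hne : (E.mem s (lastIdx hn)).Nonempty) :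
    ∃ v, r = .value (some v) := by
  have h1 := ctrl_of_returns hi h
    (fun c => c = .getLast ∨ (∃ snap, snap.Nonempty ∧ c = .testEmpty snap) ∨ ∃ snap, c = .retMin snap)
    (.inl rfl) (by
      rintro t' ht' c c' ht (rfl | ⟨snap, hs, rfl⟩ | ⟨snap, rfl⟩)
      · cases ht
        exact .inr (.inl ⟨_, hne.mono (mem_mono ht' _), rfl⟩)
      · cases ht
        · exact .inr (.inr ⟨_, rfl⟩)
        · contradiction
      · cases ht
        exact .inr (.inr ⟨_, rfl⟩))
  have h2 := ret_of_returns h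
  generalize E.ctrl p t = c at h1 h2
  cases h2 with
  | retMin snap h => exact ⟨_, rfl⟩
  | _ => simp at h1

/-- Reduces validity and agreement to statements about the contents of the last weak set. -/
theorem mem_of_returns_value {p : Fin n} {s t : ℕ} {v : V}
    (h : E.Returns p s t (.value (some v))) : v ∈ E.mem t (lastIdx hn) := by
  have h2 := ret_of_returns h
  have h3 := sound (E := E) p t
  generalize E.ctrl p t = c at h2 h3
  cases h2
  exact h3.2 (Finset.min'_mem _ _)

/-! ## Validity -/

/-- Some `propose v` was started before time `t`. -/
def Proposed (E : Execution (algorithm V n hn)) (t : ℕ) (v : V) : Prop :=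
  ∃ q s, s < t ∧ E.Invokes q s (.propose v)

/-- The values stored by a process that is performing a `propose`. -/
def _root_.SafeAgreement.Ctrl.values : Ctrl V n → Set V
  | .input v | .loop v _ | .addView v _ | .getSnap v _ => {v}
  | .test _ _ snap | .update _ snap => snap
  | _ => ∅

/-- Memory and local values need a joint induction: `add` carries values from the latter to the
former, `get` carries them back. -/
theorem proposed_of_stored (t : ℕ) :
    (∀ i, ∀ v ∈ E.mem t i, E.Proposed t v) ∧ ∀ p, ∀ v ∈ (E.ctrl p t).values, E.Proposed t v := by
  induction t with
  | zero => simp [mem_zero, ctrl_zero, Ctrl.values]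
  | succ t ih =>
    have mono : ∀ {v}, E.Proposed t v → E.Proposed (t + 1) v :=
      fun ⟨q, s, hs, h⟩ => ⟨q, s, by omega, h⟩
    refine ⟨fun i v hv => ?_, fun p v hv => ?_⟩
    · rcases E.mem_succ t with ⟨h, -⟩ | ⟨q, j, w, ha, hm⟩
      · exact mono (ih.1 i v (h ▸ hv))
      · rw [hm] at hv
        rcases eq_or_ne i j with rfl | hij
        · rw [Function.update_self, Finset.mem_insert] at hv
          rcases hv with rfl | hv
          · exact mono (ih.2 q v (by rw [ha.2]; exact rfl))
          · exact mono (ih.1 i v hv)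
        · exact mono (ih.1 i v (by simpa [hij] using hv))
    · have ih2 := ih.2 p
      rcases E.moves p t with ⟨hc, -, -, -⟩ | ⟨req, he, hc, -, -⟩ | ⟨he, hc, -, -⟩ |
        ⟨r, -, -, hc, -, -⟩
      · exact mono (ih2 v (hc ▸ hv))
      · rw [hc] at hv
        cases req with
        | propose w =>
          obtain rfl : v = w := hv
          exact ⟨p, t, by omega, he⟩
        | resolve => exact hv.elim
      · generalize E.ctrl p t = c at hc ih2
        generalize E.ctrl p (t + 1) = c' at hc hv
        cases hc with
        | input | loop | addView | testPass | updateStuck => exact mono (ih2 v hv)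
        | getSnap w i => exact mono (ih.1 i v hv)
        | update i snap h =>
          obtain rfl : v = _ := hv
          exact mono (ih2 _ (Finset.min'_mem _ _))
        | _ => exact hv.elim
      · rw [hc] at hv
        exact hv.elim

/-! ## The history of a process -/

variable (E) in
/-- Process `p` started a `propose` before time `t`. -/
def Started (p : Fin n) (t : ℕ) : Prop := ∃ s v, s < t ∧ E.Invokes p s (.propose v)

variable (E) in
/-- Before time `t`, process `p` added nothing to the weak sets from `k` on. -/
def NoAddFrom (p : Fin n) (k t : ℕ) : Prop :=
  ∀ (j : Fin n) (v : V) (s : ℕ), k ≤ j.val → s < t → ¬ E.Adds p j v s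

variable (E) in
/-- Before time `t`, process `p` added `v` to the weak set `i` and later got `snap` from it. -/
def Snaps (p i : Fin n) (v : V) (snap : Finset V) (t : ℕ) : Prop :=
  ∃ s s', s < s' ∧ s' < t ∧ E.Adds p i v s ∧ snap = E.mem s' i

variable (E) in
/-- Before time `t`, process `p` left the loop iteration `i` with the view `w`. -/
def Passes (p i : Fin n) (w : V) (t : ℕ) : Prop :=
  ∃ v snap, E.Snaps p i v snap t ∧ ¬ (2 ≤ snap.card ∧ snap.min = (v : WithTop V)) ∧
    ∃ h : snap.Nonempty, w = snap.min' h

variable (E) in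
/-- Before time `t`, process `p` has executed the loop of its `propose`. -/
def Finished (p : Fin n) (t : ℕ) : Prop :=
  (∃ j v snap, E.Snaps p j v snap t ∧ (2 ≤ snap.card ∧ snap.min = (v : WithTop V)) ∧
    E.NoAddFrom p (j.val + 1) t) ∨ ∃ v s, s < t ∧ E.Adds p (lastIdx hn) v s

variable (E) in
/-- What the control point of a process tells about its past. -/
def History (p : Fin n) (t : ℕ) : Ctrl V n → Prop
  | .input _ => E.Started p t ∧ E.NoAddFrom p 0 t
  | .loop w k => E.Started p t ∧ E.NoAddFrom p k t ∧ k ≤ n ∧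
      ∀ i : Fin n, i.val + 1 = k → E.Passes p i w t
  | .addView w k => E.Started p t ∧ E.NoAddFrom p k t ∧
      ∀ i : Fin n, i.val + 1 = k → E.Passes p i w t
  | .getSnap v i => E.Started p t ∧ E.NoAddFrom p (i.val + 1) t ∧ ∃ s, s < t ∧ E.Adds p i v s
  | .test v i snap => E.Started p t ∧ E.NoAddFrom p (i.val + 1) t ∧ E.Snaps p i v snap t
  | .update i snap => E.Started p t ∧ E.NoAddFrom p (i.val + 1) t ∧
      ∃ v, E.Snaps p i v snap t ∧ ¬ (2 ≤ snap.card ∧ snap.min = (v : WithTop V))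
  | .ack => E.Started p t ∧ E.Finished p t
  | _ => (¬ E.Started p t ∧ E.NoAddFrom p 0 t) ∨ (E.Started p t ∧ E.Finished p t)

theorem Started.succ {p : Fin n} {t : ℕ} (h : E.Started p t) : E.Started p (t + 1) := by
  obtain ⟨s, v, hs, h⟩ := h
  exact ⟨s, v, by omega, h⟩

theorem NoAddFrom.succ {p : Fin n} {k t : ℕ} (h : E.NoAddFrom p k t)
    (h' : ∀ (j : Fin n) v, k ≤ j.val → ¬ E.Adds p j v t) : E.NoAddFrom p k (t + 1) := by
  intro j v s hj hs
  rcases Nat.lt_succ_iff_lt_or_eq.mp hs with hs | rfl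
  · exact h j v s hj hs
  · exact h' j v hj

theorem Snaps.succ {p i : Fin n} {v : V} {snap : Finset V} {t : ℕ} (h : E.Snaps p i v snap t) :
    E.Snaps p i v snap (t + 1) := by
  obtain ⟨s, s', h1, h2, h3⟩ := h
  exact ⟨s, s', h1, by omega, h3⟩

theorem Passes.succ {p i : Fin n} {w : V} {t : ℕ} (h : E.Passes p i w t) :
    E.Passes p i w (t + 1) := by
  obtain ⟨v, snap, h1, h2⟩ := h
  exact ⟨v, snap, h1.succ, h2⟩

theorem Finished.succ {p : Fin n} {t : ℕ} (h : E.Finished p t)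
    (h' : ∀ j v, ¬ E.Adds p j v t) : E.Finished p (t + 1) := by
  rcases h with ⟨j, v, snap, h1, h2, h3⟩ | ⟨v, s, hs, h⟩
  · exact .inl ⟨j, v, snap, h1.succ, h2, h3.succ fun _ _ _ => h' _ _⟩
  · exact .inr ⟨v, s, by omega, h⟩

theorem not_started_succ {p : Fin n} {t : ℕ} (h : ¬ E.Started p t)
    (h' : ∀ v, E.event t ≠ some (.invoke p (.propose v))) : ¬ E.Started p (t + 1) := by
  rintro ⟨s, v, hs, hi⟩
  rcases Nat.lt_succ_iff_lt_or_eq.mp hs with hs | rfl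
  · exact h ⟨s, v, hs, hi⟩
  · exact h' v hi

/-- Time may pass while a process makes no step. -/
theorem History.succ {p : Fin n} {t : ℕ} {c : Ctrl V n} (h : E.History p t c)
    (ha : ∀ j v, ¬ E.Adds p j v t) (hi : ∀ v, E.event t ≠ some (.invoke p (.propose v))) :
    E.History p (t + 1) c := by
  have na : ∀ {k}, E.NoAddFrom p k t → E.NoAddFrom p k (t + 1) :=
    fun h => h.succ fun _ _ _ => ha _ _
  cases c with
  | input v => exact ⟨h.1.succ, na h.2⟩
  | loop v k => exact ⟨h.1.succ, na h.2.1, h.2.2.1, fun i hi => (h.2.2.2 i hi).succ⟩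
  | addView v k => exact ⟨h.1.succ, na h.2.1, fun i hi => (h.2.2 i hi).succ⟩
  | getSnap v i =>
    obtain ⟨h1, h2, s, hs, h3⟩ := h
    exact ⟨h1.succ, na h2, s, by omega, h3⟩
  | test v i snap => exact ⟨h.1.succ, na h.2.1, h.2.2.succ⟩
  | update i snap =>
    obtain ⟨h1, h2, v, h3, h4⟩ := h
    exact ⟨h1.succ, na h2, v, h3.succ, h4⟩
  | ack => exact ⟨h.1.succ, h.2.succ ha⟩
  | _ =>
    exact h.imp (fun h => ⟨not_started_succ h.1 hi, na h.2⟩) (fun h => ⟨h.1.succ, h.2.succ ha⟩)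

theorem History.quiet {p : Fin n} {t : ℕ} {c : Ctrl V n} (h : E.History p t c)
    (hc : ¬ c.Proposing ∨ c = .ack) :
    (¬ E.Started p t ∧ E.NoAddFrom p 0 t) ∨ (E.Started p t ∧ E.Finished p t) := by
  cases c <;> simp [Ctrl.Proposing] at hc <;> first | exact h | exact .inr h

theorem ctrl_eq_idle {p : Fin n} {t : ℕ} (hb : E.pend p t = false) :
    E.ctrl p t = .idle := by
  induction t with
  | zero => exact ctrl_zero _ _
  | succ t ih =>
    rcases E.moves p t with ⟨hc, hp, -, -⟩ | ⟨_, -, -, -, hp⟩ | ⟨_, _, _, hp⟩ | ⟨_, _, _, hc, _, _⟩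
    · exact hc.trans (ih (hp.symm.trans hb))
    · simp [hb] at hp
    · simp [hb] at hp
    · exact hc

/-- Source of the facts used later: one addition per process and weak set, the origin of each view,
and how a finished proposal ended. -/
theorem history (p : Fin n) (t : ℕ) : E.History p t (E.ctrl p t) := by
  induction t with
  | zero =>
    rw [ctrl_zero]
    exact .inl ⟨by rintro ⟨s, v, hs, -⟩; omega, by intro _ _ s _ hs; omega⟩
  | succ t ih =>
    rcases E.moves p t with ⟨hc, -, hi, hs⟩ | ⟨req, he, hc, hp, -⟩ | ⟨he, hc, -, -⟩ |
      ⟨r, he, hr, hc, -, -⟩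
    · rw [hc]
      exact ih.succ (fun j v h => hs (.inl h.1)) fun v => hi _
    · have hidle := ctrl_eq_idle hp
      rw [hidle] at ih
      rw [hc]
      cases req with
      | propose v =>
        refine ⟨⟨t, v, by omega, he⟩, ?_⟩
        -- One-shot use excludes an earlier proposal, so the process has added nothing so far.
        rcases ih with ⟨-, h⟩ | ⟨⟨s, w, hs, hw⟩, -⟩
        · exact h.succ fun _ _ _ h => by simp [Adds, he] at h
        · exact absurd (E.one_shot p s t w v hw he) hs.ne
      | resolve =>
        exact History.succ (c := .getLast) ih (fun _ _ h => by simp [Adds, he] at h) (by simp [he])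
    · have hi : ∀ v, E.event t ≠ some (.invoke p (.propose v)) := by simp [he]
      generalize hct : E.ctrl p t = c at hc ih
      generalize E.ctrl p (t + 1) = c' at hc
      -- Only an addition can break the `NoAddFrom` clauses; in all other cases `History.succ` first
      -- moves the old history to time `t + 1`.
      by_cases hadd : ∃ v i, c = .addView v i
      · obtain ⟨v, i, rfl⟩ := hadd
        cases hc
        refine ⟨ih.1.succ, ?_, t, by omega, he, hct⟩
        refine NoAddFrom.succ (fun j w s hj hs => ih.2.1 j w s (by omega) hs) ?_
        rintro j w hj ⟨-, h⟩
        obtain ⟨-, rfl⟩ : v = w ∧ i = j := by simpa using hct.symm.trans h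
        omega
      have ha : ∀ j v, ¬ E.Adds p j v t := fun j v h => hadd ⟨v, j, hct.symm.trans h.2⟩
      have ih' := ih.succ ha hi
      cases hc with
      | idle => exact ih'
      | input v => exact ⟨ih'.1, ih'.2, Nat.zero_le _, fun i hi => absurd hi (by omega)⟩
      | loop v i => exact ⟨ih'.1, ih'.2.1, ih'.2.2.2⟩
      | loopEnd v i h =>
        obtain ⟨h1, -, h2, h3⟩ := ih'
        -- The counter is exactly `n` here, so the last iteration was passed, and this includes an
        -- addition to the last weak set.
        obtain ⟨w, snap, ⟨s, s', h4, h5, h6, -⟩, -⟩ := h3 (lastIdx hn) (by simp [lastIdx]; omega)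
        exact ⟨h1, .inr ⟨w, s, by omega, h6⟩⟩
      | addView v i => exact absurd ⟨v, i, rfl⟩ hadd
      | getSnap v i =>
        -- The history at time `t`, not `t + 1`, is needed: the addition must strictly precede the
        -- `get` at time `t`.
        obtain ⟨-, -, s, hs, h⟩ := ih
        exact ⟨ih'.1, ih'.2.1, s, t, hs, by omega, h, rfl⟩
      | testAck v i snap h => exact ⟨ih'.1, .inl ⟨i, v, snap, ih'.2.2, h, ih'.2.1⟩⟩
      | testPass v i snap h => exact ⟨ih'.1, ih'.2.1, v, ih'.2.2, h⟩
      | update i snap h =>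
        obtain ⟨h1, h2, v, h3, h4⟩ := ih'
        refine ⟨h1, h2, i.isLt, fun j hj => ?_⟩
        obtain rfl : j = i := Fin.ext (by omega)
        exact ⟨v, snap, h3, h4, h, rfl⟩
      | updateStuck i snap h => exact ih'
      | getLast | testNonempty | testEmpty | retMinStuck => exact ih'
    · rw [hc]
      have ih' := ih.succ (fun _ _ h => by simp [Adds, he] at h) (by simp [he])
      refine History.quiet ih' ?_
      generalize E.ctrl p t = c at hr
      cases hr <;> simp [Ctrl.Proposing]

/-- A process adds at most once to each weak set. -/
theorem Adds.unique {p i : Fin n} {v w : V} {s t : ℕ} (h : E.Adds p i v s) (h' : E.Adds p i w t) :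
    s = t ∧ v = w := by
  have key : ∀ {v w s t}, E.Adds p i v s → E.Adds p i w t → ¬ s < t := by
    intro v w s t h h' hst
    have := E.history p t
    rw [h'.2] at this
    exact this.2.1 i v s le_rfl hst h
  obtain rfl : s = t := by
    have h1 := key h h'
    have h2 := key h' h
    omega
  have := h.2.symm.trans h'.2
  simp only [Ctrl.addView.injEq] at this
  exact ⟨rfl, this.1⟩

/-- Past the first weak set, a view can only be the minimum of the snapshot of the preceding
iteration. -/
theorem Adds.passes {p i j : Fin n} {w : V} {t : ℕ} (h : E.Adds p j w t) (hij : i.val + 1 = j.val) :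
    E.Passes p i w t := by
  have := E.history p t
  rw [h.2] at this
  exact this.2.2 i hij

/-! ## Agreement -/

/-- The number of processes that reach the weak set `i` is at most `n - i`, unless at most one value
is added to it. -/
theorem adders_or_subsingleton (T i : ℕ) (hi : i < n) :
    (∃ P : Finset (Fin n), P.card ≤ n - i ∧ ∀ p v s, s < T → E.Adds p ⟨i, hi⟩ v s → p ∈ P) ∨
      ∃ m, ∀ v ∈ E.mem T ⟨i, hi⟩, v = m := by
  induction i with
  | zero => exact .inl ⟨Finset.univ, by simp, by simp⟩
  | succ i ih =>
    have hi' : i < n := by omega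
    set k : Fin n := ⟨i, hi'⟩
    set k' : Fin n := ⟨i + 1, hi⟩
    have pass : ∀ {p w t}, E.Adds p k' w t → E.Passes p k w t := fun h => h.passes rfl
    by_cases hne : (E.mem T k).Nonempty
    swap
    -- Reaching `k'` requires an earlier addition to `k`, so nobody got there before `T`.
    · left
      refine ⟨∅, by simp, fun p v s hs ha => ?_⟩
      obtain ⟨w, snap, ⟨s₁, s₂, h1, h2, h3, -⟩, -⟩ := pass ha
      exact absurd ⟨w, h3.mem_of_lt (by omega)⟩ hne
    set m := (E.mem T k).min' hne
    have hmmem : m ∈ E.mem T k := Finset.min'_mem _ _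
    have hmle : ∀ v ∈ E.mem T k, m ≤ v := fun v hv => Finset.min'_le _ _ hv
    have hex : ∃ s, s < T ∧ ∃ q, E.Adds q k m s := by
      obtain ⟨q, s, hs, h⟩ := exists_adds_of_mem hmmem
      exact ⟨s, hs, q, h⟩
    classical
    obtain ⟨hsT, q, hq⟩ := Nat.find_spec hex
    have hmin : ∀ s', s' < Nat.find hex → ∀ q', ¬ E.Adds q' k m s' := fun s' hs' q' h' =>
      Nat.find_min hex hs' ⟨by omega, q', h'⟩
    generalize Nat.find hex = s at hsT hq hmin
    by_cases hemp : E.mem s k = ∅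
    -- Every addition to `k` happens at time `s` or later, so every snapshot contains `m`, and its
    -- minimum is `m`.
    · right
      refine ⟨m, fun v hv => ?_⟩
      obtain ⟨p, t, ht, ha⟩ := exists_adds_of_mem hv
      obtain ⟨w, snap, ⟨s₁, s₂, h1, h2, h3, rfl⟩, -, hn', rfl⟩ := pass ha
      have hs : s ≤ s₁ := by
        by_contra hlt
        have := h3.mem_of_lt (t := s) (by omega)
        simp [hemp] at this
      refine le_antisymm (Finset.min'_le _ _ (hq.mem_of_lt (by omega))) ?_
      exact hmle _ (mem_mono (by omega) k (Finset.min'_mem _ _))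
    · obtain ⟨w, hw⟩ := Finset.nonempty_iff_ne_empty.mpr hemp
      have hwm : w ≠ m := by
        rintro rfl
        obtain ⟨q', s', hs', h'⟩ := exists_adds_of_mem hw
        exact hmin s' hs' q' h'
      -- The snapshot of `q` contains `w` and `m`, and its minimum is `m`, so the test sends `q` to
      -- `return ACK`.
      have hqn : ∀ v t, t < T → ¬ E.Adds q k' v t := by
        intro v t ht ha
        obtain ⟨v', snap, ⟨s₁, s₂, h1, h2, h3, rfl⟩, h4, -⟩ := pass ha
        obtain ⟨rfl, hv'⟩ := h3.unique hq
        subst hv'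
        have hv2 := h3.mem_of_lt h1
        refine h4 ⟨?_, ?_⟩
        · exact Finset.one_lt_card.mpr ⟨w, mem_mono (by omega) k hw, _, hv2, hwm⟩
        · refine le_antisymm (Finset.min_le hv2) (Finset.le_min fun a ha => ?_)
          exact WithTop.coe_le_coe.mpr (hmle a (mem_mono (by omega) k ha))
      rcases ih hi' with ⟨P, hP, hP'⟩ | ⟨m', hm'⟩
      · left
        refine ⟨P.erase q, ?_, fun p v t ht ha => ?_⟩
        · rw [Finset.card_erase_of_mem (hP' q m s hsT hq)]
          omega
        · refine Finset.mem_erase.mpr ⟨?_, ?_⟩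
          · rintro rfl
            exact hqn v t ht ha
          · obtain ⟨v', snap, ⟨s₁, s₂, h1, h2, h3, -⟩, -⟩ := pass ha
            exact hP' p v' s₁ (by omega) h3
      -- Two distinct values `w` and `m` are in `k`, so this alternative of the induction hypothesis
      -- is impossible.
      · exact absurd ((hm' w (mem_mono hsT.le k hw)).trans (hm' m hmmem).symm) hwm

/-- At most one value is ever added to the last weak set. -/
theorem eq_of_mem_last {T : ℕ} {v w : V} (hv : v ∈ E.mem T (lastIdx hn))
    (hw : w ∈ E.mem T (lastIdx hn)) : v = w := by
  rcases adders_or_subsingleton (E := E) T (n - 1) (Nat.sub_lt hn Nat.one_pos) with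
    ⟨P, hP, hP'⟩ | ⟨m, hm⟩
  · obtain ⟨p, s, hs, h⟩ := exists_adds_of_mem hv
    obtain ⟨q, t, ht, h'⟩ := exists_adds_of_mem hw
    -- At the last index the bound is `n - (n - 1) = 1` adder, and `Adds.unique` gives it a single
    -- value.
    obtain rfl : p = q :=
      Finset.card_le_one.mp (by omega) p (hP' p v s hs h) q (hP' q w t ht h')
    exact (h.unique h').2
  · exact (hm v hv).trans (hm w hw).symm

/-! ## Nontriviality -/

/-- The hypothesis of `Nontriviality` only constrains crashes after the invocation; this excludes
the earlier ones. -/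
theorem not_crash_before_invoke {p : Fin n} {s u : ℕ} {req : Request V}
    (hc : E.event s = some (.crash p)) (hi : E.Invokes p u req) : ¬ s < u := by
  intro hsu
  have : ∀ t, s + 1 ≤ t → (E.config t).crashed p = true := by
    intro t ht
    induction t, ht using Nat.le_induction with
    | base =>
      have h := E.config_succ_of_some s _ hc
      generalize E.config (s + 1) = c' at h
      cases h
      simp
    | succ t _ ih =>
      rcases he : E.event t with _ | e
      · rw [E.config_succ_of_none t he, ih]
      have h := E.config_succ_of_some t e he
      generalize E.config (t + 1) = c' at h
      cases h with
      | crash q _ =>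
        by_cases hq : p = q
        · simp [hq]
        · simpa [hq] using ih
      | _ => exact ih
  have h1 := this u hsu
  have h := E.config_succ_of_some u _ hi
  generalize E.config (u + 1) = c' at h
  cases h
  simp_all

theorem not_proposing_mono {p : Fin n} {s t : ℕ} (hst : s ≤ t) (h : E.Started p s)
    (hc : ¬ (E.ctrl p s).Proposing) : ¬ (E.ctrl p t).Proposing := by
  induction t, hst using Nat.le_induction with
  | base => exact hc
  | succ t ht ih =>
    rcases E.moves p t with ⟨hc, -, -, -⟩ | ⟨req, he, hc, -, -⟩ | ⟨he, hc, -, -⟩ |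
      ⟨r, he, hr, hc, -, -⟩
    · rwa [hc]
    · rw [hc]
      cases req with
      | propose v =>
        obtain ⟨u, w, hu, hw⟩ := h
        have := E.one_shot p u t w v hw he
        omega
      | resolve => exact id
    · generalize E.ctrl p t = c at hc ih
      generalize E.ctrl p (t + 1) = c' at hc
      cases hc <;> first | exact id | exact ih
    · rw [hc]
      exact id

/-- By one-shot use, a process that has left its proposal never enters another, and outside a
proposal the history of a started process says that it is finished. -/
theorem finished_after_return {p : Fin n} {u t : ℕ} {v : V} {r : Response V}
    (hi : E.Invokes p u (.propose v)) (hr : E.Returns p u t r) {T : ℕ} (hT : t < T) :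
    E.Finished p T := by
  have hst : E.Started p (t + 1) := ⟨u, v, by have := hr.1; omega, hi⟩
  have hidle : E.ctrl p (t + 1) = .idle := by
    have h1 := hr.2.1
    rcases E.moves p t with ⟨-, -, -, hs⟩ | ⟨_, he, -, -, -⟩ | ⟨he, _, _, _⟩ | ⟨r', _, _, hc, _, _⟩
    · exact absurd (Or.inr ⟨r, h1⟩) hs
    · simp [he] at h1
    · simp [he] at h1
    · exact hc
  have hnp := not_proposing_mono hT hst (by rw [hidle]; exact id)
  rcases (E.history p T).quiet (.inl hnp) with ⟨h, -⟩ | ⟨-, h⟩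
  · exact absurd ⟨u, v, by have := hr.1; omega, hi⟩ h
  · exact h

theorem started_of_adds {p i : Fin n} {v : V} {s : ℕ} (h : E.Adds p i v s) : E.Started p s := by
  have := E.history p s
  rw [h.2] at this
  exact this.1

/-- If all `propose` operations that are ever started have been executed at time `T`, and there is
at least one, then the last weak set is nonempty. -/
theorem last_nonempty {T : ℕ} (hfin : ∀ q u v, E.Invokes q u (.propose v) → E.Finished q T)
    (hex : ∃ q u v, E.Invokes q u (.propose v)) : (E.mem T (lastIdx hn)).Nonempty := by
  have hfin' : ∀ {p i v s}, E.Adds p i v s → E.Finished p T := fun h => by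
    obtain ⟨s, v, -, h⟩ := started_of_adds h
    exact hfin _ _ _ h
  have hlast : (∃ v p s, s < T ∧ E.Adds p (lastIdx hn) v s) → (E.mem T (lastIdx hn)).Nonempty :=
    fun ⟨v, p, s, hs, h⟩ => ⟨v, h.mem_of_lt hs⟩
  by_contra hcon
  have hne : (Finset.univ.filter fun i : Fin n => (E.mem T i).Nonempty).Nonempty := by
    obtain ⟨q, u, v, hq⟩ := hex
    rcases hfin q u v hq with ⟨j, w, snap, ⟨s, s', h1, h2, h3, -⟩, -⟩ | ⟨w, s, hs, h⟩
    · exact ⟨j, by simpa using ⟨w, h3.mem_of_lt (by omega)⟩⟩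
    · exact absurd (hlast ⟨w, q, s, hs, h⟩) hcon
  -- The highest nonempty weak set; `q` below is a process that added its maximum.
  obtain ⟨i, hi, himax⟩ := Finset.exists_max_image _ id hne
  have hi : (E.mem T i).Nonempty := by simpa using hi
  obtain ⟨q, s, hs, hq⟩ := exists_adds_of_mem (Finset.max'_mem _ hi)
  rcases hfin' hq with ⟨j, v, snap, ⟨s₁, s₂, h1, h2, h3, rfl⟩, ⟨h4, h5⟩, h6⟩ | ⟨w, s, hs, h⟩
  -- `q` stopped at `j`: not before `i`, where it added a value, and not after `i`, since higher
  -- weak sets are empty.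
  · have hij : i ≤ j := by
      by_contra hlt
      exact h6 i _ s (by simp at hlt; omega) hs hq
    have hji : j ≤ i := himax j (by simpa using ⟨v, h3.mem_of_lt (by omega)⟩)
    obtain rfl := le_antisymm hij hji
    obtain ⟨-, rfl⟩ := h3.unique hq
    -- The value of `q` is both the minimum of its snapshot and the maximum of the weak set, which
    -- leaves no room for a second element `a`.
    obtain ⟨a, ha, hne⟩ := Finset.exists_mem_ne h4 ((E.mem T i).max' hi)
    have h7 : ((E.mem T i).max' hi) ≤ a := by
      have := Finset.min_le ha
      rw [h5] at this
      exact WithTop.coe_le_coe.mp this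
    exact hne (le_antisymm (Finset.le_max' _ _ (mem_mono (by omega) i ha)) h7)
  · exact hcon (hlast ⟨w, q, s, hs, h⟩)

theorem exists_finished_time (hret : ∀ q u v, E.Invokes q u (.propose v) → ∃ t r, E.Returns q u t r) :
    ∃ T, ∀ q u v, E.Invokes q u (.propose v) → E.Finished q T := by
  -- Asking for all later times allows the times of the finitely many processes to be replaced by
  -- their supremum.
  have : ∀ q, ∃ T, ∀ T', T ≤ T' → ∀ u v, E.Invokes q u (.propose v) → E.Finished q T' := by
    intro q
    by_cases h : ∃ u v, E.Invokes q u (.propose v)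
    · obtain ⟨u, v, h⟩ := h
      obtain ⟨t, r, hr⟩ := hret q u v h
      exact ⟨t + 1, fun T' hT' _ _ _ => finished_after_return h hr hT'⟩
    · exact ⟨0, fun _ _ u v h' => absurd ⟨u, v, h'⟩ h⟩
  choose f hf using this
  exact ⟨Finset.univ.sup f, fun q u v h => hf q _ (Finset.le_sup (Finset.mem_univ q)) u v h⟩

end Execution

/-! ### The properties of the algorithm -/

open Execution

theorem waitFree_algorithm : WaitFree (algorithm V n hn) :=
  fun _ _ _ _ hi hinf => exists_returns_of_infinite hi hinf

theorem responseTypes_algorithm : ResponseTypes (algorithm V n hn) :=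
  fun _ _ _ _ _ h => ⟨fun _ hi => (returns_propose h hi).2, fun hi => returns_resolve h hi⟩

theorem validity_algorithm : Validity (algorithm V n hn) := fun E _ _ t v _ h =>
  (proposed_of_stored (E := E) t).1 _ v (mem_of_returns_value h)

theorem agreement_algorithm : Agreement (algorithm V n hn) :=
  fun _ _ _ _ t _ t' _ _ _ h _ h' =>
    eq_of_mem_last (mem_mono (le_max_left t t') _ (mem_of_returns_value h))
      (mem_mono (le_max_right t t') _ (mem_of_returns_value h'))

theorem termination_algorithm : Termination (algorithm V n hn) :=
  fun _ hF _ _ _ hi hp => exists_returns_of_fair hF hi hp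

theorem nontriviality_algorithm : Nontriviality (algorithm V n hn) := by
  intro E hF hex hcrash
  -- A proposer may still crash after its proposal has returned; only a crash that prevents the
  -- return has to be excluded.
  have hret : ∀ q u v, E.Invokes q u (.propose v) → ∃ t r, E.Returns q u t r := by
    intro q u v hi
    by_contra hcon
    refine hcon (exists_returns_of_fair hF hi ?_)
    rintro ⟨c, hc⟩
    rcases lt_trichotomy c u with h | rfl | h
    · exact not_crash_before_invoke hc hi h
    · simp [Invokes, hc] at hi
    · obtain ⟨t, r, -, h⟩ := hcrash q u v hi c h hc
      exact hcon ⟨t, r, h⟩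
  obtain ⟨T, hT⟩ := exists_finished_time hret
  have hne := last_nonempty hT hex
  exact ⟨T, fun _ _ _ _ hs hi hr => returns_resolve_of_nonempty hr hi (hne.mono (mem_mono hs _))⟩

end Proof

end SafeAgreement

theorem mainTheorem4 {V : Type*} [LinearOrder V] (n : ℕ) (hn : 0 < n) :
    SafeAgreement.Anonymous (SafeAgreement.algorithm V n hn) ∧
    SafeAgreement.WaitFree (SafeAgreement.algorithm V n hn) ∧
    SafeAgreement.ResponseTypes (SafeAgreement.algorithm V n hn) ∧
    SafeAgreement.Validity (SafeAgreement.algorithm V n hn) ∧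
    SafeAgreement.Agreement (SafeAgreement.algorithm V n hn) ∧
    SafeAgreement.Termination (SafeAgreement.algorithm V n hn) ∧
    SafeAgreement.Nontriviality (SafeAgreement.algorithm V n hn) :=
  ⟨fun _ _ => rfl, SafeAgreement.waitFree_algorithm, SafeAgreement.responseTypes_algorithm,
    SafeAgreement.validity_algorithm, SafeAgreement.agreement_algorithm,
    SafeAgreement.termination_algorithm, SafeAgreement.nontriviality_algorithm⟩
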